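/- Let $p$ be a prime, let $n\ge 4$ and $1\le k<n$ be integers with $n/\gcd(n,k)\ge 3$, and let $c\in\mathbb F_{p^n}$ with $c\ne 1$. For a function $G:\mathbb F_{p^n}\to\mathbb F_{p^n}$ let $$\delta_{G,c}=\max_{a,b}\ \#\{x\in\mathbb F_{p^n}: G(x+a)-c\,G(x)=b\}$$ be its $c$-differential uniformity, the maximum being over all $a,b\in\mathbb F_{p^n}$ (as $c\neq 1$, the value $a=0$ is allowed). (i) Let $0\le t<n$ and $G(x)=x^{p^k+1}+x^{p^t}$. Then $\delta_{G,c}\le\max\{p^k+1,\,p^t\}$. If moreover $x^{p^k-p^t+1}+1=0$ for some nonzero $x\in\mathbb F_{p^n}$ (the exponent may be negative), then also $\gcd(p^k-p^t+1,\,p^n-1)+1\le\delta_{G,c}$. (ii) If $G(x)=x^{p^k+1}+x$ or $G(x)=x^{p^k+1}+x^{p^k}$, then $p^{\gcd(n,k)}+1\le\delta_{G,c}\le p^k+1$. -/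

import Mathlib

section CDifferential

variable {K : Type*} [Field K] [Fintype K]

open Classical in
/-- The entry at `(a, b)` of the `c`-difference distribution table of `F : K → K`: the number of
`x : K` with `F (x + a) - c F x = b`. -/
noncomputable def cDDT (F : K → K) (c a b : K) : ℕ :=
  (Finset.univ.filter fun x : K => F (x + a) - c * F x = b).card

open Classical in
/-- The `c`-differential uniformity of `F : K → K`: the maximum of the entries at `(a, b)` of the
`c`-difference distribution table, over all `a, b : K`, with `a ≠ 0` if `c = 1`. -/
noncomputable def cDiffUniformity (F : K → K) (c : K) : ℕ :=
  (Finset.univ.filter fun ab : K × K => c = 1 → ab.1 ≠ 0).sup fun ab => cDDT F c ab.1 ab.2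

end CDifferential

/-! For `c ≠ 1` the row `a = 0` of the table counts solutions of `(1 - c) * F x = b`, so every fibre
of `F` bounds the uniformity from below. The upper bounds are root counts for a polynomial with
leading coefficient `1 - c`. In (i) the fibre over 0 is used; in (ii), a fibre built from the
projective line over the fixed field of `x ↦ x ^ p ^ k`. -/

open Classical in
lemma card_filter_le_cDiffUniformity {K : Type*} [Field K] [Fintype K] (F : K → K) {c : K}
    (hc : c ≠ 1) (b : K) :
    (Finset.univ.filter fun x : K => F x = b).card ≤ cDiffUniformity F c := by
  have h1 : (Finset.univ.filter fun x : K => F x = b).card ≤ cDDT F c 0 ((1 - c) * b) := by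
    unfold cDDT
    apply Finset.card_le_card
    intro x hx
    simp only [Finset.mem_filter, Finset.mem_univ, true_and, add_zero] at hx ⊢
    rw [hx]
    ring
  refine h1.trans ?_
  unfold cDiffUniformity
  exact Finset.le_sup (f := fun ab : K × K => cDDT F c ab.1 ab.2)
    (b := ((0 : K), (1 - c) * b)) (by simp [hc])

lemma Finset.card_le_cDiffUniformity {K : Type*} [Field K] [Fintype K] {F : K → K} {c : K}
    (hc : c ≠ 1) (b : K) (s : Finset K) (hs : ∀ x ∈ s, F x = b) :
    s.card ≤ cDiffUniformity F c := by
  classical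
  refine le_trans (Finset.card_le_card ?_) (card_filter_le_cDiffUniformity F hc b)
  intro x hx
  simpa using hs x hx

lemma Nat.Prime.pow_add_one_ne_pow {p : ℕ} (hp : p.Prime) {k : ℕ} (hk : 1 ≤ k) (t : ℕ) :
    p ^ k + 1 ≠ p ^ t := by
  intro h
  rcases Nat.eq_zero_or_pos t with rfl | ht
  · have := pow_pos hp.pos k
    rw [pow_zero] at h
    omega
  · have h1 : p ∣ p ^ k := dvd_pow_self p (by omega)
    have h2 : p ∣ p ^ t := dvd_pow_self p (by omega)
    rw [← h] at h2
    exact hp.one_lt.ne' (Nat.dvd_one.mp ((Nat.dvd_add_right h1).mp h2))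

open Polynomial in
-- As `q + 1 ≠ s`, only one of the two powers contributes to the top coefficient, which is `1 - c`.
lemma cDiffUniformity_pow_add_pow_le {K : Type*} [Field K] [Fintype K] {c : K} (hc : c ≠ 1)
    {q s : ℕ} (h : q + 1 ≠ s) :
    cDiffUniformity (fun x : K => x ^ (q + 1) + x ^ s) c ≤ max (q + 1) s := by
  classical
  unfold cDiffUniformity
  refine Finset.sup_le ?_
  rintro ⟨a, b⟩ -
  have hs (m : ℕ) : ((X + C a : K[X]) ^ m).natDegree ≤ m := by
    simp
  have hcoeff (m : ℕ) : ((X + C a : K[X]) ^ m).coeff m = 1 := by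
    simpa [natDegree_pow] using ((monic_X_add_C a).pow m).coeff_natDegree
  set P : K[X] := (X + C a) ^ (q + 1) + (X + C a) ^ s - C c * (X ^ (q + 1) + X ^ s) - C b with hP
  have hdeg : P.natDegree ≤ max (q + 1) s := by
    refine natDegree_sub_le_of_le (natDegree_sub_le_of_le (natDegree_add_le_of_le (hs _) (hs _))
      ((natDegree_C_mul_le _ _).trans (natDegree_add_le_of_le (natDegree_X_pow_le _)
        (natDegree_X_pow_le _)))) (natDegree_C b).le |>.trans (by simp)
  have hP0 : P ≠ 0 := by
    have key : P.coeff (max (q + 1) s) = 1 - c := by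
      rcases lt_or_gt_of_ne h with h | h
      · rw [max_eq_right h.le, hP]
        have : ((X + C a : K[X]) ^ (q + 1)).coeff s = 0 :=
          coeff_eq_zero_of_natDegree_lt ((hs _).trans_lt h)
        simp [this, hcoeff, coeff_X_pow, coeff_C, h.ne', show s ≠ 0 by omega]
      · rw [max_eq_left h.le, hP]
        have : ((X + C a : K[X]) ^ s).coeff (q + 1) = 0 :=
          coeff_eq_zero_of_natDegree_lt ((hs _).trans_lt h)
        simp [this, hcoeff, coeff_X_pow, h.ne']
    intro h0
    rw [h0, coeff_zero] at key
    exact hc (sub_eq_zero.mp key.symm).symm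
  refine le_trans ?_ hdeg
  unfold cDDT
  refine card_le_degree_of_subset_roots (p := P) ?_
  intro x hx
  rw [Finset.mem_val, Finset.mem_filter] at hx
  rw [mem_roots hP0]
  simpa [IsRoot, hP, sub_eq_zero] using hx.2

lemma exists_finset_units_zpow_eq_one {K : Type*} [Field K] [Fintype K] (e : ℤ) :
    ∃ s : Finset Kˣ, s.card = Int.gcd e ((Fintype.card K : ℤ) - 1) ∧ ∀ u ∈ s, u ^ e = 1 := by
  classical
  have h := IsCyclic.card_powMonoidHom_ker (G := Kˣ) e.natAbs
  refine ⟨Finset.univ.filter (· ∈ (powMonoidHom e.natAbs : Kˣ →* Kˣ).ker), ?_, ?_⟩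
  · rw [← Fintype.card_subtype, ← Nat.card_eq_fintype_card]
    refine h.trans ?_
    rw [Nat.card_eq_fintype_card, Fintype.card_units, Int.gcd, Nat.gcd_comm]
    have := Fintype.card_pos (α := K)
    congr 1
    omega
  · intro u hu
    simpa [MonoidHom.mem_ker] using hu

/-- For `y ≠ 0` the function is `y ^ s * (y ^ e + 1)` with `e = q - s + 1`; its zeros include 0 and
the coset of the `e`-torsion of `Kˣ` through `x`. -/
lemma gcd_add_one_le_cDiffUniformity {K : Type*} [Field K] [Fintype K] {c : K} (hc : c ≠ 1)
    {q s : ℕ} (hs : s ≠ 0) (h : q + 1 ≠ s) (hx : ∃ x : K, x ^ ((q : ℤ) - s + 1) + 1 = 0) :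
    Int.gcd ((q : ℤ) - s + 1) ((Fintype.card K : ℤ) - 1) + 1
      ≤ cDiffUniformity (fun x : K => x ^ (q + 1) + x ^ s) c := by
  classical
  obtain ⟨x, hx⟩ := hx
  have hx0 : x ≠ 0 := by
    rintro rfl
    rw [zero_zpow _ (by omega)] at hx
    simp at hx
  obtain ⟨S, hS, hS1⟩ := exists_finset_units_zpow_eq_one (K := K) ((q : ℤ) - s + 1)
  have hinj : Function.Injective (fun u : Kˣ => x * (u : K)) := fun u v huv =>
    Units.ext (mul_left_cancel₀ hx0 huv)
  have hnot : (0 : K) ∉ S.image (fun u : Kˣ => x * (u : K)) := by simp [hx0]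
  have hcard : (insert 0 (S.image (fun u : Kˣ => x * (u : K)))).card = _ :=
    Finset.card_insert_of_notMem hnot
  rw [Finset.card_image_of_injective _ hinj, hS] at hcard
  rw [← hcard]
  refine Finset.card_le_cDiffUniformity hc 0 _ ?_
  intro y hy
  rw [Finset.mem_insert, Finset.mem_image] at hy
  rcases hy with rfl | ⟨u, hu, rfl⟩
  · simp [hs]
  · have hy0 : x * (u : K) ≠ 0 := mul_ne_zero hx0 u.ne_zero
    have hu1 : (u : K) ^ ((q : ℤ) - s + 1) = 1 := by
      rw [← Units.val_zpow_eq_zpow_val, hS1 u hu, Units.val_one]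
    have h1 : (x * (u : K)) ^ (q + 1) = (x * (u : K)) ^ s * (x * (u : K)) ^ ((q : ℤ) - s + 1) := by
      rw [← zpow_natCast, ← zpow_natCast, ← zpow_add₀ hy0]
      congr 1
      push_cast
      ring
    rw [h1, mul_zpow, hu1, mul_one, eq_neg_of_add_eq_zero_left hx]
    ring

lemma exists_finset_pow_prime_pow_eq_self {K : Type*} [Field K] [Fintype K] {p n k : ℕ}
    (hp : p.Prime) (hK : Fintype.card K = p ^ n) :
    ∃ s : Finset K, s.card = p ^ Nat.gcd n k ∧ ∀ x ∈ s, x ^ p ^ k = x := by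
  classical
  obtain ⟨S, hS, hS1⟩ := exists_finset_units_zpow_eq_one (K := K) ((p ^ k - 1 : ℕ) : ℤ)
  refine ⟨insert 0 (S.image fun u : Kˣ => (u : K)), ?_, ?_⟩
  · rw [Finset.card_insert_of_notMem (by simp), Finset.card_image_of_injective _ Units.val_injective,
      hS, hK]
    have h1 : ((p ^ n : ℕ) : ℤ) - 1 = ((p ^ n - 1 : ℕ) : ℤ) := by
      rw [Nat.cast_sub (Nat.one_le_pow _ _ hp.pos)]
      simp
    rw [h1, Int.gcd_natCast_natCast, Nat.pow_sub_one_gcd_pow_sub_one, Nat.gcd_comm]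
    exact Nat.sub_add_cancel (Nat.one_le_pow _ _ hp.pos)
  · intro x hx
    rw [Finset.mem_insert, Finset.mem_image] at hx
    rcases hx with rfl | ⟨u, hu, rfl⟩
    · exact zero_pow (pow_pos hp.pos k).ne'
    · have h1 := hS1 u hu
      rw [zpow_natCast] at h1
      rw [← Units.val_pow_eq_pow_val, ← Nat.sub_add_cancel (Nat.one_le_pow k p hp.pos), pow_succ,
        h1, one_mul]

lemma exists_pow_prime_pow_ne_self {K : Type*} [Field K] [Fintype K] {p n m : ℕ}
    (hp : p.Prime) (hK : Fintype.card K = p ^ n) (h : ¬ n ∣ m) : ∃ x : K, x ^ p ^ m ≠ x := by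
  classical
  by_contra! hx
  have h1 : Monoid.exponent Kˣ ∣ p ^ m - 1 := by
    refine Monoid.exponent_dvd_of_forall_pow_eq_one fun u => ?_
    have h2 : u ^ p ^ m = u := Units.ext (by simpa using hx u)
    rw [← Nat.sub_add_cancel (Nat.one_le_pow m p hp.pos), pow_succ] at h2
    exact mul_eq_right.mp h2
  rw [IsCyclic.exponent_eq_card, Nat.card_eq_fintype_card, Fintype.card_units, hK] at h1
  have h3 := Nat.gcd_eq_left h1
  rw [Nat.pow_sub_one_gcd_pow_sub_one] at h3
  have h4 := Nat.one_le_pow n p hp.pos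
  have h5 := Nat.one_le_pow (n.gcd m) p hp.pos
  have h6 : n.gcd m = n := Nat.pow_right_injective hp.two_le (by simp only; omega)
  exact h (Nat.gcd_eq_left_iff_dvd.mp h6)

lemma not_dvd_two_mul_of_three_le_div_gcd {n k : ℕ} (hn : 0 < n) (h : 3 ≤ n / Nat.gcd n k) :
    ¬ n ∣ 2 * k := by
  intro hd
  have h1 : n ∣ Nat.gcd (2 * n) (2 * k) := Nat.dvd_gcd (dvd_mul_left _ _) hd
  rw [Nat.gcd_mul_left] at h1
  have hg : 0 < Nat.gcd n k := Nat.gcd_pos_of_pos_left _ hn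
  have h2 := Nat.le_of_dvd (by omega) h1
  rw [Nat.le_div_iff_mul_le hg] at h
  omega

/-- Some fibre of `y ↦ y ^ (p ^ k + 1) + y` has at least `p ^ gcd n k + 1` elements: take the
values `z ^ (p ^ k - 1)` for `z` in the plane spanned by `1` and a suitable `θ` over the fixed
field of `x ↦ x ^ p ^ k`, and rescale. -/
lemma exists_finset_pow_add_one_add_self_eq {K : Type*} [Field K] [Fintype K] {p n k : ℕ}
    (hp : p.Prime) (hK : Fintype.card K = p ^ n) (h : ¬ n ∣ 2 * k) :
    ∃ (b : K) (s : Finset K), s.card = p ^ Nat.gcd n k + 1 ∧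
      ∀ y ∈ s, y ^ (p ^ k + 1) + y = b := by
  classical
  have : Fact p.Prime := ⟨hp⟩
  have : CharP K p := charP_of_card_eq_prime_pow hK
  obtain ⟨S, hS, hS1⟩ := exists_finset_pow_prime_pow_eq_self (k := k) hp hK
  obtain ⟨θ, hθ⟩ := exists_pow_prime_pow_ne_self hp hK h
  set q := p ^ k with hq
  set σ : K →+* K := iterateFrobenius K p k with hσ
  have hσq (x : K) : σ x = x ^ q := iterateFrobenius_def ..
  have hσσ (x : K) : σ (σ x) = x ^ p ^ (2 * k) := by
    rw [hσq, hσq, ← pow_mul, hq, ← pow_add, two_mul]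
  rw [← hσσ] at hθ
  have hθ1 : σ θ - θ ≠ 0 := fun h0 => hθ (by rw [sub_eq_zero.mp h0, sub_eq_zero.mp h0])
  have hfix (f : K) (hf : f ∈ S) : σ f = f := by rw [hσq, hS1 f hf]
  have hθf (f : K) (hf : f ∈ S) : θ + f ≠ 0 := by
    intro h0
    apply hθ1
    rw [eq_neg_of_add_eq_zero_left h0, map_neg, hfix f hf, sub_self]
  -- Chosen so that `σ (σ z) + u * σ z - (1 + u) * z` vanishes at `z = 1` and `z = θ`, hence on
  -- their span; dividing by `z` gives the equation of `hroot` for `w = σ z / z`. The choice of `θ`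
  -- makes `u ≠ 0`.
  set u : K := -(σ (σ θ) - θ) / (σ θ - θ) with hu
  have hu0 : u ≠ 0 := div_ne_zero (neg_ne_zero.mpr (sub_ne_zero.mpr hθ)) hθ1
  have hue : u * (σ θ - θ) = -(σ (σ θ) - θ) := div_mul_cancel₀ _ hθ1
  -- With `w = l * y` both nonconstant terms get the coefficient `u * l`.
  obtain ⟨l, hl⟩ : ∃ l, σ l = u := (Finite.injective_iff_surjective.mp σ.injective) u
  have hl0 : l ≠ 0 := by
    rintro rfl
    exact hu0 (by rw [← hl, map_zero])
  have hσl : σ l ≠ 0 := by rwa [hl]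
  have hroot (w : K) (hw : σ w * w + u * w - (1 + u) = 0) :
      (w / l) ^ (q + 1) + w / l = (1 + u) / (u * l) := by
    rw [pow_succ, ← hσq, map_div₀, hl]
    field_simp
    linear_combination hw
  -- The points of the projective line are represented by `θ + f` and by 1, the latter giving `w =
  -- 1`.
  set g : K → K := fun f => σ (θ + f) / (θ + f) with hg
  have hginj : Set.InjOn g S := by
    intro f hf f' hf' hff
    simp only [hg] at hff
    rw [div_eq_div_iff (hθf f hf) (hθf f' hf'), map_add, map_add, hfix f hf, hfix f' hf'] at hff
    have h0 : (f' - f) * (σ θ - θ) = 0 := by linear_combination hff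
    exact (sub_eq_zero.mp ((mul_eq_zero.mp h0).resolve_right hθ1)).symm
  have hg1 : (1 : K) ∉ S.image g := by
    rw [Finset.mem_image]
    rintro ⟨f, hf, h1⟩
    simp only [hg] at h1
    rw [div_eq_one_iff_eq (hθf f hf), map_add, hfix f hf] at h1
    exact hθ1 (by linear_combination h1)
  refine ⟨(1 + u) / (u * l), (insert 1 (S.image g)).image (· / l), ?_, ?_⟩
  · rw [Finset.card_image_of_injective _ (fun x y h => (div_left_inj' hl0).mp h), Finset.card_insert_of_notMem hg1,
      Finset.card_image_of_injOn hginj, hS]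
  · intro y hy
    rw [Finset.mem_image] at hy
    obtain ⟨w, hw, rfl⟩ := hy
    apply hroot
    rw [Finset.mem_insert, Finset.mem_image] at hw
    rcases hw with rfl | ⟨f, hf, rfl⟩
    · rw [map_one]
      ring
    · have h1 := hθf f hf
      have h2 : σ (θ + f) ≠ 0 := by rwa [Ne, map_eq_zero]
      simp only [hg, map_div₀]
      simp only [map_add, hfix f hf] at h2 ⊢
      field_simp
      linear_combination hue

theorem theorem2 {K : Type*} [Field K] [Fintype K] (p n k : ℕ) (hp : p.Prime)
    (hK : Fintype.card K = p ^ n) (hn : 4 ≤ n) (hk : 1 ≤ k) (hkn : k < n)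
    (hnk : 3 ≤ n / Nat.gcd n k) (c : K) (hc : c ≠ 1) :
    (∀ t : ℕ, t < n →
      ((∃ x : K, x ^ ((p : ℤ) ^ k - (p : ℤ) ^ t + 1) + 1 = 0) →
        Int.gcd ((p : ℤ) ^ k - (p : ℤ) ^ t + 1) ((p : ℤ) ^ n - 1) + 1
          ≤ cDiffUniformity (fun x : K => x ^ (p ^ k + 1) + x ^ (p ^ t)) c) ∧
      cDiffUniformity (fun x : K => x ^ (p ^ k + 1) + x ^ (p ^ t)) c
        ≤ max (p ^ k + 1) (p ^ t)) ∧
    (p ^ Nat.gcd n k + 1 ≤ cDiffUniformity (fun x : K => x ^ (p ^ k + 1) + x) c ∧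
      cDiffUniformity (fun x : K => x ^ (p ^ k + 1) + x) c ≤ p ^ k + 1) ∧
    (p ^ Nat.gcd n k + 1 ≤ cDiffUniformity (fun x : K => x ^ (p ^ k + 1) + x ^ (p ^ k)) c ∧
      cDiffUniformity (fun x : K => x ^ (p ^ k + 1) + x ^ (p ^ k)) c ≤ p ^ k + 1) := by
  classical
  have hne (t : ℕ) : p ^ k + 1 ≠ p ^ t := hp.pow_add_one_ne_pow hk t
  have hub (t : ℕ) := cDiffUniformity_pow_add_pow_le hc (hne t)
  have hq : 1 ≤ p ^ k := Nat.one_le_pow _ _ hp.pos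
  obtain ⟨b, s, hs, hsb⟩ := exists_finset_pow_add_one_add_self_eq hp hK
    (not_dvd_two_mul_of_three_le_div_gcd (by omega) hnk)
  refine ⟨fun t _ => ⟨fun hx => ?_, hub t⟩, ⟨?_, ?_⟩, ?_, ?_⟩
  · have h := gcd_add_one_le_cDiffUniformity hc (pow_pos hp.pos t).ne' (hne t)
      (by simpa using hx)
    rw [hK] at h
    simpa using h
  · rw [← hs]
    exact Finset.card_le_cDiffUniformity hc b s hsb
  · simpa [hq] using hub 0
  -- The substitution `x = -1 - y` turns `x ^ q * (x + 1)` into `(y ^ q + 1) * y`, where `q = p ^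
  -- k`.
  · rw [← hs, ← Finset.card_image_of_injective s (f := fun y => -1 - y) sub_right_injective]
    refine Finset.card_le_cDiffUniformity hc b _ ?_
    intro x hx
    obtain ⟨y, hy, rfl⟩ := Finset.mem_image.mp hx
    have : Fact p.Prime := ⟨hp⟩
    have : CharP K p := charP_of_card_eq_prime_pow hK
    have h1 : (-1 - y) ^ p ^ k = -1 - y ^ p ^ k := by
      rw [← iterateFrobenius_def, ← iterateFrobenius_def, map_sub, map_neg, map_one]
    have h2 := hsb y hy
    rw [pow_succ] at h2 ⊢
    rw [h1]
    linear_combination h2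
  · simpa using hub k
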